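/- Let $k$ be a commutative ring and let $A$ be a $k$-linear Hopf category with class of objects $X$. That is, $A$ consists of $k$-coalgebras $(A_{x,y},\Delta_{x,y},\varepsilon_{x,y})$ for $x,y\in X$, together with coalgebra morphisms $m_{x,y,z}: A_{x,y}\otimes A_{y,z}\to A_{x,z}$, $a\otimes b\mapsto ab$, and $\eta_x: k\to A_{x,x}$, $\eta_x(1)=1_x$, such that $(ab)c=a(bc)$ and $1_x a=a=a1_y$ for all $a\in A_{x,y}$, $b\in A_{y,z}$, $c\in A_{z,t}$, and with $k$-linear maps $S_{x,y}: A_{x,y}\to A_{y,x}$ (the antipode maps) satisfying $$h_{(1)}S_{x,y}(h_{(2)})=\varepsilon_{x,y}(h)1_x\quad\text{and}\quad S_{x,y}(h_{(1)})h_{(2)}=\varepsilon_{x,y}(h)1_y$$ for all $x,y\in X$ and $h\in A_{x,y}$, where $\Delta_{x,y}(h)=h_{(1)}\otimes h_{(2)}$ (Sweedler notation). Assume that every $A_{x,y}$ is finitely generated and projective as a $k$-module. Then the antipode map $S_{x,y}: A_{x,y}\to A_{y,x}$ is bijective for all $x,y\in X$. -/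

import Mathlib

open scoped TensorProduct

/-- A category enriched in the monoidal category of `k`-coalgebras, with class of objects `X` and
with hom-coalgebras `A x y`: the multiplications `A x y ⊗ A y z → A x z` and the units
`k → A x x` are morphisms of `k`-coalgebras, and they are associative and unital. -/
structure CoalgEnrichedCategory (k : Type*) [CommRing k] {X : Type*} (A : X → X → Type*)
    [∀ x y, AddCommGroup (A x y)] [∀ x y, Module k (A x y)] [∀ x y, Coalgebra k (A x y)] where
  /-- The multiplication `m_{x,y,z}`, a coalgebra morphism. -/
  mul : ∀ x y z, A x y ⊗[k] A y z →ₗc[k] A x z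
  /-- The unit `η_x`, a coalgebra morphism. -/
  unit : ∀ x, k →ₗc[k] A x x
  mul_assoc : ∀ x y z t,
    (mul x y t).toLinearMap ∘ₗ (mul y z t).toLinearMap.lTensor (A x y) ∘ₗ
        (TensorProduct.assoc k (A x y) (A y z) (A z t)).toLinearMap =
      (mul x z t).toLinearMap ∘ₗ (mul x y z).toLinearMap.rTensor (A z t)
  unit_mul : ∀ x y,
    (mul x x y).toLinearMap ∘ₗ (unit x).toLinearMap.rTensor (A x y) =
      (TensorProduct.lid k (A x y)).toLinearMap
  mul_unit : ∀ x y,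
    (mul x y y).toLinearMap ∘ₗ (unit y).toLinearMap.lTensor (A x y) =
      (TensorProduct.rid k (A x y)).toLinearMap

/-- A `k`-linear Hopf category: a category enriched in `k`-coalgebras, together with an antipode,
that is, a family of `k`-linear maps `S_{x,y} : A x y → A y x` with
`h₍₁₎ S(h₍₂₎) = ε(h) 1_x` and `S(h₍₁₎) h₍₂₎ = ε(h) 1_y` for all `h` in `A x y`. -/
structure HopfCategory (k : Type*) [CommRing k] {X : Type*} (A : X → X → Type*)
    [∀ x y, AddCommGroup (A x y)] [∀ x y, Module k (A x y)] [∀ x y, Coalgebra k (A x y)]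
    extends CoalgEnrichedCategory k A where
  /-- The antipode maps `S_{x,y}`. -/
  antipode : ∀ x y, A x y →ₗ[k] A y x
  mul_antipode_lTensor_comul : ∀ x y,
    (mul x y x).toLinearMap ∘ₗ (antipode x y).lTensor (A x y) ∘ₗ Coalgebra.comul =
      (unit x).toLinearMap ∘ₗ Coalgebra.counit
  mul_antipode_rTensor_comul : ∀ x y,
    (mul y x y).toLinearMap ∘ₗ (antipode x y).rTensor (A x y) ∘ₗ Coalgebra.comul =
      (unit y).toLinearMap ∘ₗ Coalgebra.counit

/-! It suffices to give every `S : A x z → A z x` a linear left inverse. For opposite antipodes with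
left inverses `L` and `L'`, the map `L' ∘ L` is then a surjective endomorphism of a finitely
generated module, hence injective, and this makes `L` a two-sided inverse.

The left inverse comes from integrals on the Hopf algebra `A x x`. If `t` is an integral, then `t(b₂
S(a)) b₁ = t(b S(a₁)) a₂` (`contract_comp_antipode`), which lets one recover `t(c) a` linearly from
`S a`, for every `c` (`preimage_antipode`). So it is enough to find integrals `tᵢ` and elements `cᵢ`
with `∑ tᵢ(cᵢ) = 1`; no single generating integral is needed, which is why `k` may be any
commutative ring.

Such integrals are traces: for a linear form `f`, the trace of `b ↦ contract f (c S²(b))`, as a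
function of `c`, is an integral (`isIntegral_traceForm`). Taking for `f` the forms `e' i` of a dual
basis and `cᵢ = S (e i)`, the values add up to `ε(1) = 1` (`sum_traceForm`). -/

/-! ### Bilinear functions and dual bases. -/

/-- Bilinearity of an unbundled function of two variables. -/
structure IsBilin (k : Type*) {C D M : Type*} [CommRing k] [AddCommGroup C] [Module k C]
    [AddCommGroup D] [Module k D] [AddCommGroup M] [Module k M] (F : C → D → M) : Prop where
  add_left : ∀ p p' q, F (p + p') q = F p q + F p' q
  smul_left : ∀ (r : k) p q, F (r • p) q = r • F p q
  add_right : ∀ p q q', F p (q + q') = F p q + F p q'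
  smul_right : ∀ (r : k) p q, F p (r • q) = r • F p q

theorem isBilin_iff {k C D M : Type*} [CommRing k] [AddCommGroup C] [Module k C]
    [AddCommGroup D] [Module k D] [AddCommGroup M] [Module k M] (F : C → D → M) :
    IsBilin k F ↔ (∀ p p' q, F (p + p') q = F p q + F p' q) ∧
      (∀ (r : k) p q, F (r • p) q = r • F p q) ∧ (∀ p q q', F p (q + q') = F p q + F p q') ∧
      (∀ (r : k) p q, F p (r • q) = r • F p q) :=
  ⟨fun h => ⟨h.1, h.2, h.3, h.4⟩, fun h => ⟨h.1, h.2.1, h.2.2.1, h.2.2.2⟩⟩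

/-- The linear map on the tensor product defined by a bilinear function. -/
noncomputable def IsBilin.lift {k C D M : Type*} [CommRing k] [AddCommGroup C] [Module k C]
    [AddCommGroup D] [Module k D] [AddCommGroup M] [Module k M] {F : C → D → M} (h : IsBilin k F) : C ⊗[k] D →ₗ[k] M :=
  TensorProduct.lift (LinearMap.mk₂ k F h.1 h.2 h.3 h.4)

@[simp]
theorem IsBilin.lift_tmul {k C D M : Type*} [CommRing k] [AddCommGroup C] [Module k C]
    [AddCommGroup D] [Module k D] [AddCommGroup M] [Module k M] {F : C → D → M} (h : IsBilin k F) (p : C) (q : D) :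
    h.lift (p ⊗ₜ q) = F p q := by
  simp [IsBilin.lift]

theorem isBilin_tmul {k C D : Type*} [CommRing k] [AddCommGroup C] [Module k C]
    [AddCommGroup D] [Module k D] : IsBilin k (fun (p : C) (q : D) => p ⊗ₜ[k] q) := by
  constructor <;> intros <;>
    simp [TensorProduct.add_tmul, TensorProduct.tmul_add, TensorProduct.smul_tmul']

theorem sum_dualBasis_smul_map {k C M ι : Type*} [CommRing k] [AddCommGroup C] [Module k C]
    [AddCommGroup M] [Module k M] [Fintype ι] {e : ι → C} {e' : ι → C →ₗ[k] k}
    (he : ∀ c, ∑ j, e' j c • e j = c) {f : C → M} (hf : IsLinearMap k f) (c : C) :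
    ∑ j, e' j c • f (e j) = f c := by
  simpa using congrArg (hf.mk' f) (he c)

theorem sum_apply_smul_dualBasis {k C ι : Type*} [CommRing k] [AddCommGroup C] [Module k C]
    [Fintype ι] {e : ι → C} {e' : ι → C →ₗ[k] k}
    (he : ∀ c, ∑ j, e' j c • e j = c) (f : C →ₗ[k] k) : ∑ j, f (e j) • e' j = f := by
  ext c
  simpa [mul_comm] using congrArg f (he c)

/-! ### Sweedler calculus for a coalgebra. -/

section Sweedler

variable {k C D M N : Type*} [CommRing k] [AddCommGroup C] [Module k C] [Coalgebra k C]
  [AddCommGroup D] [Module k D] [Coalgebra k D]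
  [AddCommGroup M]

variable (k) in
/-- The Sweedler sum `F(a₍₁₎, a₍₂₎)`, computed with an arbitrary representation of the
comultiplication of `a`. It is independent of the representation when `F` is bilinear. -/
noncomputable def sw (F : C → C → M) (a : C) : M :=
  ∑ i ∈ (Coalgebra.Repr.arbitrary k a).index,
    F ((Coalgebra.Repr.arbitrary k a).left i) ((Coalgebra.Repr.arbitrary k a).right i)

theorem sw_congr {F G : C → C → M} (h : ∀ p q, F p q = G p q) (a : C) : sw k F a = sw k G a := by
  simp [sw, h]

@[simp]
theorem sw_add_fun (F G : C → C → M) (a : C) :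
    sw k (fun p q => F p q + G p q) a = sw k F a + sw k G a := by
  simp [sw, Finset.sum_add_distrib]

theorem sw_comm (F : C → C → D → D → M) (a : C) (b : D) :
    sw k (fun p q => sw k (fun u v => F p q u v) b) a =
      sw k (fun u v => sw k (fun p q => F p q u v) a) b := by
  simp only [sw]
  exact Finset.sum_comm

theorem sw_finset_sum {ι : Type*} (s : Finset ι) (F : ι → C → C → M) (a : C) :
    sw k (fun p q => ∑ i ∈ s, F i p q) a = ∑ i ∈ s, sw k (F i) a := by
  simp only [sw]
  exact Finset.sum_comm

variable [Module k M] [AddCommGroup N] [Module k N]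

@[simp]
theorem sw_smul_fun (r : k) (F : C → C → M) (a : C) :
    sw k (fun p q => r • F p q) a = r • sw k F a := by
  simp [sw, Finset.smul_sum]

theorem map_sw (g : M →ₗ[k] N) (F : C → C → M) (a : C) :
    g (sw k F a) = sw k (fun p q => g (F p q)) a := by
  simp [sw]

theorem map_sw_apply {P : Type*} [AddCommGroup P] [Module k P] (B : M →ₗ[k] N →ₗ[k] P)
    (F : C → C → M) (a : C) (n : N) : B (sw k F a) n = sw k (fun p q => B (F p q) n) a := by
  simp [sw]

theorem sw_tmul (B : C ⊗[k] C →ₗ[k] M) (a : C) :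
    sw k (fun p q => B (p ⊗ₜ q)) a = B (Coalgebra.comul a) := by
  rw [← (Coalgebra.Repr.arbitrary k a).eq, map_sum, sw]

theorem sw_eq {F : C → C → M} (h : IsBilin k F) (a : C) :
    sw k F a = h.lift (Coalgebra.comul a) := by
  rw [← sw_tmul]
  exact sw_congr (fun p q => (h.lift_tmul p q).symm) a

theorem sw_eq_comul (a : C) : sw k (fun p q => p ⊗ₜ[k] q) a = Coalgebra.comul a :=
  sw_tmul LinearMap.id a

@[simp]
theorem sw_add {F : C → C → M} (h : IsBilin k F) (a b : C) :
    sw k F (a + b) = sw k F a + sw k F b := by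
  simp [sw_eq h]

@[simp]
theorem sw_smul {F : C → C → M} (h : IsBilin k F) (r : k) (a : C) :
    sw k F (r • a) = r • sw k F a := by
  simp [sw_eq h]

theorem sw_coassoc (F : C → C → C → M) (h₁ : ∀ c, IsBilin k (fun a b => F a b c))
    (h₂ : ∀ a, IsBilin k (F a)) (a : C) :
    sw k (fun p q => sw k (fun u v => F u v q) p) a =
      sw k (fun p q => sw k (fun u v => F p u v) q) a := by
  let T : C ⊗[k] (C ⊗[k] C) →ₗ[k] M := TensorProduct.lift
    { toFun := fun p => (h₂ p).lift
      map_add' := fun p p' => TensorProduct.ext' fun u v => by simp [(h₁ v).add_left]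
      map_smul' := fun r p => TensorProduct.ext' fun u v => by simp [(h₁ v).smul_left] }
  have hT : ∀ p u v, T (p ⊗ₜ (u ⊗ₜ v)) = F p u v := fun p u v => by simp [T]
  have hl : ∀ p q, sw k (fun u v => F u v q) p =
      (T ∘ₗ (TensorProduct.assoc k C C C).toLinearMap ∘ₗ
        (Coalgebra.comul (R := k)).rTensor C) (p ⊗ₜ q) := fun p q => by
    have := sw_tmul ((T ∘ₗ (TensorProduct.assoc k C C C).toLinearMap) ∘ₗ
      (TensorProduct.mk k (C ⊗[k] C) C).flip q) p
    simpa [hT] using this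
  have hr : ∀ p q, sw k (fun u v => F p u v) q =
      (T ∘ₗ (Coalgebra.comul (R := k)).lTensor C) (p ⊗ₜ q) := fun p q => by
    have := sw_tmul (T ∘ₗ TensorProduct.mk k C (C ⊗[k] C) p) q
    simpa [hT] using this
  simp only [hl, hr, sw_tmul]
  exact congrArg T (Coalgebra.coassoc_apply a)

theorem sw_counit_left {f : C → M} (hf : IsLinearMap k f) (a : C) :
    sw k (fun p q => (Coalgebra.counit p : k) • f q) a = f a := by
  have := congrArg (hf.mk' f) (Coalgebra.sum_counit_smul (R := k) (Coalgebra.Repr.arbitrary k a))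
  simpa [sw] using this

theorem sw_counit_right {f : C → M} (hf : IsLinearMap k f) (a : C) :
    sw k (fun p q => (Coalgebra.counit q : k) • f p) a = f a := by
  have h := Coalgebra.sum_tmul_counit_eq (R := k) (Coalgebra.Repr.arbitrary k a)
  have := congrArg (fun z => hf.mk' f (TensorProduct.rid k C z)) h
  simpa only [sw, map_sum, TensorProduct.rid_tmul, one_smul, map_smul, IsLinearMap.mk'_apply]
    using this

theorem sw_map {F : D → D → M} (h : IsBilin k F) (φ : C →ₗc[k] D) (a : C) :
    sw k F (φ a) = sw k (fun p q => F (φ p) (φ q)) a := by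
  rw [sw_eq h, ← CoalgHomClass.map_comp_comul_apply, ← LinearMap.comp_apply, ← sw_tmul]
  simp

theorem sw_tmul_base {F : C ⊗[k] D → C ⊗[k] D → M} (h : IsBilin k F) (a : C) (b : D) :
    sw k F (a ⊗ₜ b) =
      sw k (fun p q => sw k (fun u v => F (p ⊗ₜ u) (q ⊗ₜ v)) b) a := by
  -- The coproducts are replaced by variables so that the chosen representations can be substituted
  -- for them.
  have h' : ∀ (x : C ⊗[k] C) (y : D ⊗[k] D), x = Coalgebra.comul a → y = Coalgebra.comul b →
      sw k F (a ⊗ₜ b) =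
        h.lift (TensorProduct.AlgebraTensorModule.tensorTensorTensorComm k k k k C C D D (x ⊗ₜ y)) := by
    rintro x y rfl rfl
    rw [sw_eq h, TensorProduct.comul_tmul]
  rw [h' _ _ (Coalgebra.Repr.arbitrary k a).eq (Coalgebra.Repr.arbitrary k b).eq]
  simp only [TensorProduct.sum_tmul, TensorProduct.tmul_sum, map_sum, sw,
    TensorProduct.AlgebraTensorModule.tensorTensorTensorComm_tmul, IsBilin.lift_tmul]
  exact Finset.sum_comm

theorem tmul_sw (F : C → C → M) (n : N) (a : C) :
    n ⊗ₜ[k] sw k F a = sw k (fun p q => n ⊗ₜ[k] F p q) a := by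
  simp only [sw, TensorProduct.tmul_sum]

theorem sw_tmul_right (F : C → C → M) (n : N) (a : C) :
    sw k F a ⊗ₜ[k] n = sw k (fun p q => F p q ⊗ₜ[k] n) a := by
  simp only [sw, TensorProduct.sum_tmul]

/-- A left inverse and a right inverse under convolution coincide, for convolution products
with values in modules between which associative multiplications are given. -/
theorem convolution_inverse_unique {P Q R R' : Type*} [AddCommGroup P] [Module k P]
    [AddCommGroup Q] [Module k Q] [AddCommGroup R] [Module k R] [AddCommGroup R'] [Module k R']
    (m₁ : P →ₗ[k] Q →ₗ[k] R) (m₂ : Q →ₗ[k] P →ₗ[k] R') (l : R →ₗ[k] P →ₗ[k] P)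
    (r : P →ₗ[k] R' →ₗ[k] P) (assoc : ∀ p q p', l (m₁ p q) p' = r p (m₂ q p'))
    (e : R) (e' : R') (l_one : ∀ p, l e p = p) (r_one : ∀ p, r p e' = p)
    (f h : C →ₗ[k] P) (g : C →ₗ[k] Q)
    (hfg : ∀ c, sw k (fun p q => m₁ (f p) (g q)) c = (Coalgebra.counit c : k) • e)
    (hgh : ∀ c, sw k (fun p q => m₂ (g p) (h q)) c = (Coalgebra.counit c : k) • e') (c : C) :
    f c = h c := by
  -- The two bracketings of the convolution product `f * g * h`; coassociativity identifies them.
  have h₁ : sw k (fun p q => r (f p) (sw k (fun u v => m₂ (g u) (h v)) q)) c = f c := by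
    simp only [hgh, map_smul, r_one]
    exact sw_counit_right (IsLinearMap.mk (map_add f) (map_smul f)) c
  have h₂ : sw k (fun p q => l (sw k (fun u v => m₁ (f u) (g v)) p) (h q)) c = h c := by
    simp only [hfg, map_smul, LinearMap.smul_apply, l_one]
    exact sw_counit_left (IsLinearMap.mk (map_add h) (map_smul h)) c
  rw [← h₁, ← h₂]
  simp only [map_sw_apply]
  simp only [map_sw, ← assoc]
  refine (sw_coassoc (k := k) (fun a b c : C => l (m₁ (f a) (g b)) (h c)) ?_ ?_ c).symm
  · intro; constructor <;> intros <;> simp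
  · intro; constructor <;> intros <;> simp

/-- The map `b ↦ f(b₍₂₎) b₍₁₎` defined by a linear form `f`. -/
noncomputable def contract (f : C →ₗ[k] k) : C →ₗ[k] C :=
  (TensorProduct.rid k C).toLinearMap ∘ₗ f.lTensor C ∘ₗ Coalgebra.comul

theorem contract_apply (f : C →ₗ[k] k) (b : C) :
    contract f b = sw k (fun p q => f q • p) b := by
  have := sw_tmul ((TensorProduct.rid k C).toLinearMap ∘ₗ f.lTensor C) b
  simpa [contract] using this.symm

@[simp]
theorem contract_add (f g : C →ₗ[k] k) (b : C) :
    contract (f + g) b = contract f b + contract g b := by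
  simp [contract_apply, add_smul]

@[simp]
theorem contract_smul (r : k) (f : C →ₗ[k] k) (b : C) :
    contract (r • f) b = r • contract f b := by
  simp [contract_apply, mul_smul]

theorem apply_contract (f g : C →ₗ[k] k) (b : C) :
    f (contract g b) = sw k (fun p q => g q * f p) b := by
  simp [contract_apply, map_sw]

theorem counit_contract (f : C →ₗ[k] k) (b : C) : Coalgebra.counit (R := k) (contract f b) = f b := by
  rw [apply_contract]
  simpa [mul_comm] using sw_counit_left (IsLinearMap.mk (map_add f) (map_smul f)) b

/-- By coassociativity, `contract f` touches only the last tensor factor, so it is colinear for the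
left coaction. -/
theorem sw_contract {F : C → C → M} (h : IsBilin k F) (f : C →ₗ[k] k) (b : C) :
    sw k F (contract f b) = sw k (fun p q => F p (contract f q)) b := by
  have h₁ : ∀ p q, F p (contract f q) = sw k (fun u v => f v • F p u) q := fun p q => by
    have := map_sw (IsLinearMap.mk' (F p) ⟨h.add_right p, fun r => h.smul_right r p⟩)
      (fun u v => f v • u) q
    rw [← contract_apply] at this
    simpa [h.smul_right] using this
  have h₂ := map_sw (IsLinearMap.mk' (sw k F) ⟨sw_add h, sw_smul h⟩) (fun u v => f v • u) b
  rw [← contract_apply] at h₂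
  simp only [IsLinearMap.mk'_apply, sw_smul h] at h₂
  simp only [h₁, h₂]
  rw [← sw_coassoc (fun p u v => f v • F p u)]
  · simp
  · intro; constructor <;> intros <;> simp [h.1, h.2, h.3, h.4, smul_smul, mul_comm]
  · intro; constructor <;> intros <;> simp [h.3, h.4, add_smul, smul_smul, mul_comm]

section DualBasis

variable {ι : Type*} [Fintype ι] {e : ι → C} {e' : ι → C →ₗ[k] k}
  (he : ∀ c, ∑ j, e' j c • e j = c)
include he

theorem sw_eq_sum_dualBasis {F : C → C → M} (h : IsBilin k F) (c : C) :
    sw k F c = ∑ l, ∑ m, e' l (contract (e' m) c) • F (e l) (e m) := by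
  -- Both arguments are expanded in the dual basis.
  have h₁ : ∀ p q, F p q = ∑ l, ∑ m, (e' m q * e' l p) • F (e l) (e m) := fun p q => by
    rw [← sum_dualBasis_smul_map he (f := fun p => F p q) ⟨fun _ _ => h.1 _ _ _, fun _ _ => h.2 _ _ _⟩ p]
    refine Finset.sum_congr rfl fun l _ => ?_
    rw [← sum_dualBasis_smul_map he (f := fun q => F (e l) q) ⟨fun _ _ => h.3 _ _ _, fun _ _ => h.4 _ _ _⟩ q,
      Finset.smul_sum]
    exact Finset.sum_congr rfl fun m _ => by rw [smul_smul, mul_comm]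
  rw [sw_congr h₁]
  simp only [sw_finset_sum, apply_contract]
  refine Finset.sum_congr rfl fun l _ => Finset.sum_congr rfl fun m _ => ?_
  simp only [sw, Finset.sum_smul]

/-- The coalgebra structure and the dual algebra structure correspond to each other under the
canonical element `∑ e' j ⊗ e j`. -/
theorem sum_sw_dualBasis {G : (C →ₗ[k] k) → C → C → M} (h₁ : ∀ p q, IsLinearMap k (fun f => G f p q))
    (h₂ : ∀ f, IsBilin k (G f)) :
    ∑ j, sw k (G (e' j)) (e j) = ∑ l, ∑ m, G (e' l ∘ₗ contract (e' m)) (e l) (e m) := by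
  simp only [sw_eq_sum_dualBasis he (h₂ _)]
  rw [Finset.sum_comm]
  refine Finset.sum_congr rfl fun l _ => ?_
  rw [Finset.sum_comm]
  refine Finset.sum_congr rfl fun m _ => ?_
  -- `e' l ∘ₗ contract (e' m)` is the convolution product of `e' l` and `e' m`; its coordinates are
  -- its values on the `e j`.
  conv_rhs => rw [← sum_apply_smul_dualBasis he (e' l ∘ₗ contract (e' m))]
  have := map_sum ((h₁ (e l) (e m)).mk' _)
    (fun j => (e' l ∘ₗ contract (e' m)) (e j) • e' j) Finset.univ
  simp only [IsLinearMap.mk'_apply] at this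
  rw [this]
  exact Finset.sum_congr rfl fun j _ => ((h₁ (e l) (e m)).map_smul _ _).symm

end DualBasis

end Sweedler

/-! ### Composition, units and the anti-multiplicativity of the antipode. -/

namespace HopfCategory

variable {k X : Type*} [CommRing k] {A : X → X → Type*}
  [∀ x y, AddCommGroup (A x y)] [∀ x y, Module k (A x y)] [∀ x y, Coalgebra k (A x y)]
  (H : HopfCategory k A)

/-- Composition of elements, `a b` for `a` in `A x y` and `b` in `A y z`. -/
noncomputable def comp {x y z : X} (a : A x y) (b : A y z) : A x z := H.mul x y z (a ⊗ₜ b)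

/-- The unit element `1_x`. -/
def one (x : X) : A x x := H.unit x 1

local infixl:70 " ⋆ " => comp H

local notation "S" => HopfCategory.antipode H _ _

variable {x y z t : X}

theorem isBilin_comp : IsBilin k (fun (a : A x y) (b : A y z) => a ⋆ b) := by
  constructor <;> intros <;> simp [comp, TensorProduct.add_tmul, TensorProduct.tmul_add, ← TensorProduct.smul_tmul']

@[simp] theorem add_comp (a a' : A x y) (b : A y z) : (a + a') ⋆ b = a ⋆ b + a' ⋆ b :=
  (isBilin_comp H).add_left a a' b

@[simp] theorem comp_add (a : A x y) (b b' : A y z) : a ⋆ (b + b') = a ⋆ b + a ⋆ b' :=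
  (isBilin_comp H).add_right a b b'

@[simp] theorem smul_comp (r : k) (a : A x y) (b : A y z) : (r • a) ⋆ b = r • (a ⋆ b) :=
  (isBilin_comp H).smul_left r a b

@[simp] theorem comp_smul (r : k) (a : A x y) (b : A y z) : a ⋆ (r • b) = r • (a ⋆ b) :=
  (isBilin_comp H).smul_right r a b

theorem comp_assoc (a : A x y) (b : A y z) (c : A z t) : a ⋆ b ⋆ c = a ⋆ (b ⋆ c) := by
  simpa [comp] using (LinearMap.congr_fun (H.mul_assoc x y z t) ((a ⊗ₜ b) ⊗ₜ c)).symm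

@[simp] theorem one_comp (a : A x y) : H.one x ⋆ a = a := by
  simpa [comp, one] using LinearMap.congr_fun (H.unit_mul x y) (1 ⊗ₜ a)

@[simp] theorem comp_one (a : A x y) : a ⋆ H.one y = a := by
  simpa [comp, one] using LinearMap.congr_fun (H.mul_unit x y) (a ⊗ₜ 1)

theorem comp_sw {M : Type*} [AddCommGroup M] [Module k M] [Coalgebra k M] (a : A x y) (F : M → M → A y z) (m : M) :
    a ⋆ sw k F m = sw k (fun p q => a ⋆ F p q) m := by
  simp only [comp, sw, TensorProduct.tmul_sum, map_sum]

theorem sw_comp {M : Type*} [AddCommGroup M] [Module k M] [Coalgebra k M] (b : A y z) (F : M → M → A x y) (m : M) :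
    sw k F m ⋆ b = sw k (fun p q => F p q ⋆ b) m := by
  simp only [comp, sw, TensorProduct.sum_tmul, map_sum]

theorem sw_comp_base {M : Type*} [AddCommGroup M] [Module k M] {F : A x z → A x z → M}
    (h : IsBilin k F) (a : A x y) (b : A y z) :
    sw k F (a ⋆ b) = sw k (fun p q => sw k (fun u v => F (p ⋆ u) (q ⋆ v)) b) a := by
  rw [comp, sw_map h, sw_tmul_base]
  · rfl
  · constructor <;> intros <;> simp [h.1, h.2, h.3, h.4]

theorem counit_comp (a : A x y) (b : A y z) :
    Coalgebra.counit (R := k) (a ⋆ b) = Coalgebra.counit (R := k) a * Coalgebra.counit (R := k) b := by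
  rw [comp, CoalgHomClass.counit_comp_apply, TensorProduct.counit_tmul, smul_eq_mul, mul_comm]

theorem counit_one : Coalgebra.counit (R := k) (H.one x) = 1 := by
  rw [one, CoalgHomClass.counit_comp_apply]
  rfl

theorem sw_one {M : Type*} [AddCommGroup M] [Module k M] {F : A x x → A x x → M}
    (h : IsBilin k F) : sw k F (H.one x) = F (H.one x) (H.one x) := by
  rw [one, sw_map h, sw_eq (F := fun p q : k => F (H.unit x p) (H.unit x q)),
    CommSemiring.comul_apply, IsBilin.lift_tmul]
  constructor <;> intros <;> simp only [map_add, map_smul, h.1, h.2, h.3, h.4]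

theorem sw_comp_antipode (a : A x y) :
    sw k (fun p q => p ⋆ S q) a = Coalgebra.counit (R := k) a • H.one x := by
  have h := LinearMap.congr_fun (H.mul_antipode_lTensor_comul x y) a
  have h1 := sw_tmul ((H.mul x y x).toLinearMap ∘ₗ (H.antipode x y).lTensor (A x y)) a
  simp only [LinearMap.comp_apply] at h h1
  rw [h] at h1
  rw [one, ← map_smul, smul_eq_mul, mul_one]
  exact h1

theorem sw_antipode_comp (a : A x y) :
    sw k (fun p q => S p ⋆ q) a = Coalgebra.counit (R := k) a • H.one y := by
  have h := LinearMap.congr_fun (H.mul_antipode_rTensor_comul x y) a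
  have h1 := sw_tmul ((H.mul y x y).toLinearMap ∘ₗ (H.antipode x y).rTensor (A x y)) a
  simp only [LinearMap.comp_apply] at h h1
  rw [h] at h1
  rw [one, ← map_smul, smul_eq_mul, mul_one]
  exact h1

theorem antipode_one : S (H.one x) = H.one x := by
  have h := H.sw_comp_antipode (H.one x)
  rw [sw_one, counit_one, one_smul, one_comp] at h
  · exact h
  · constructor <;> intros <;> simp

/-- Composition as a bilinear map. -/
noncomputable def compL (x y z : X) : A x y →ₗ[k] A y z →ₗ[k] A x z :=
  TensorProduct.curry (H.mul x y z).toLinearMap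

theorem compL_apply (a : A x y) (b : A y z) : H.compL x y z a b = a ⋆ b := rfl

/-- The antipode reverses composition. -/
theorem antipode_comp (a : A x y) (b : A y z) : S (a ⋆ b) = S b ⋆ S a := by
  -- `f` and `h` are a left and a right convolution inverse of the multiplication `A x y ⊗ A y z → A
  -- x z`.
  let f : A x y ⊗[k] A y z →ₗ[k] A z x := H.antipode x z ∘ₗ (H.mul x y z).toLinearMap
  let h : A x y ⊗[k] A y z →ₗ[k] A z x :=
    TensorProduct.lift (((H.compL z y x).compl₁₂ (H.antipode y z) (H.antipode x y)).flip)
  refine convolution_inverse_unique (H.compL z x z) (H.compL x z x) (H.compL z z x)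
    (H.compL z x x) (fun p q r => H.comp_assoc p q r) (H.one z) (H.one x) H.one_comp H.comp_one
    f h (H.mul x y z).toLinearMap ?_ ?_ (a ⊗ₜ b)
  · have hB : IsBilin k (fun p q => H.compL z x z (f p) ((H.mul x y z).toLinearMap q)) := by
      constructor <;> intros <;> simp
    intro c
    induction c using TensorProduct.induction_on with
    | zero => rw [sw_eq hB, map_zero, map_zero, map_zero, zero_smul]
    | add c d hc hd => rw [sw_add hB, hc, hd, map_add, add_smul]
    | tmul a b =>
      rw [sw_tmul_base hB]
      have := H.sw_antipode_comp (a ⋆ b)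
      rw [sw_comp_base, counit_comp] at this
      · rw [TensorProduct.counit_tmul, smul_eq_mul, mul_comm]
        exact this
      · constructor <;> intros <;> simp
  · have hB : IsBilin k (fun p q => H.compL x z x ((H.mul x y z).toLinearMap p) (h q)) := by
      constructor <;> intros <;> simp
    intro c
    induction c using TensorProduct.induction_on with
    | zero => rw [sw_eq hB, map_zero, map_zero, map_zero, zero_smul]
    | add c d hc hd => rw [sw_add hB, hc, hd, map_add, add_smul]
    | tmul a b =>
      rw [sw_tmul_base hB]
      have key : ∀ p q : A x y, sw k (fun u v => p ⋆ u ⋆ (S v ⋆ S q)) b =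
          (Coalgebra.counit (R := k) b) • (p ⋆ S q) := fun p q => by
        have h1 : ∀ u v : A y z, p ⋆ u ⋆ H.comp (H.antipode y z v) (H.antipode x y q) =
            p ⋆ (H.comp (H.comp u (H.antipode y z v)) (H.antipode x y q)) := fun u v => by
          simp only [comp_assoc]
        simp only [h1]
        rw [← comp_sw, ← sw_comp, sw_comp_antipode, smul_comp, comp_smul, one_comp]
      rw [TensorProduct.counit_tmul, smul_eq_mul, mul_smul, ← sw_comp_antipode, ← sw_smul_fun]
      exact sw_congr (fun p q => key p q) a

/-- Composition on the tensor squares of the hom-modules, factor by factor. -/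
noncomputable def compT (x y z : X) :
    A x y ⊗[k] A x y →ₗ[k] A y z ⊗[k] A y z →ₗ[k] A x z ⊗[k] A x z :=
  TensorProduct.curry (TensorProduct.map (H.mul x y z).toLinearMap (H.mul x y z).toLinearMap ∘ₗ
    (TensorProduct.tensorTensorTensorComm k (A x y) (A x y) (A y z) (A y z)).toLinearMap)

@[simp]
theorem compT_tmul (a a' : A x y) (b b' : A y z) :
    H.compT x y z (a ⊗ₜ a') (b ⊗ₜ b') = (a ⋆ b) ⊗ₜ (a' ⋆ b') := rfl

theorem compT_assoc (a : A x y ⊗[k] A x y) (b : A y z ⊗[k] A y z) (c : A z t ⊗[k] A z t) :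
    H.compT x z t (H.compT x y z a b) c = H.compT x y t a (H.compT y z t b c) := by
  induction a using TensorProduct.induction_on with
  | zero => simp
  | add a a' h h' => simp [h, h']
  | tmul a a' =>
    induction b using TensorProduct.induction_on with
    | zero => simp
    | add b b' h h' => simp only [map_add, LinearMap.add_apply, h, h']
    | tmul b b' =>
      induction c using TensorProduct.induction_on with
      | zero => simp
      | add c c' h h' => simp only [map_add, h, h']
      | tmul c c' => simp [comp_assoc]

theorem comul_comp (a : A x y) (b : A y z) :
    Coalgebra.comul (R := k) (a ⋆ b) = H.compT x y z (Coalgebra.comul a) (Coalgebra.comul b) := by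
  rw [← sw_eq_comul, sw_comp_base _ (isBilin_tmul), ← sw_eq_comul a, ← sw_eq_comul b, map_sw_apply]
  simp only [map_sw, compT_tmul]

theorem comul_one : Coalgebra.comul (R := k) (H.one x) = H.one x ⊗ₜ H.one x := by
  rw [← sw_eq_comul, sw_one _ isBilin_tmul]

/-- The antipode reverses comultiplication. -/
theorem comul_antipode (a : A x y) :
    Coalgebra.comul (R := k) (S a) = sw k (fun p q => S q ⊗ₜ[k] S p) a := by
  -- `f` and `h` are a left and a right convolution inverse of the comultiplication of `A x y`.
  let f : A x y →ₗ[k] A y x ⊗[k] A y x := Coalgebra.comul ∘ₗ H.antipode x y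
  let h : A x y →ₗ[k] A y x ⊗[k] A y x :=
    TensorProduct.map (H.antipode x y) (H.antipode x y) ∘ₗ
      (TensorProduct.comm k (A x y) (A x y)).toLinearMap ∘ₗ Coalgebra.comul
  have hh : ∀ c, h c = sw k (fun p q => S q ⊗ₜ[k] S p) c := fun c =>
    (sw_tmul (TensorProduct.map (H.antipode x y) (H.antipode x y) ∘ₗ
      (TensorProduct.comm k (A x y) (A x y)).toLinearMap) c).symm
  rw [← hh]
  refine convolution_inverse_unique (H.compT y x y) (H.compT x y x) (H.compT y y x)
    (H.compT y x x) H.compT_assoc (H.one y ⊗ₜ H.one y) (H.one x ⊗ₜ H.one x) ?_ ?_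
    f h (Coalgebra.comul) ?_ ?_ a
  · intro p
    induction p using TensorProduct.induction_on with
    | zero => simp
    | add a a' h h' => simp [h, h']
    | tmul a a' => simp
  · intro p
    induction p using TensorProduct.induction_on with
    | zero => simp
    | add a a' h h' => simp [h, h']
    | tmul a a' => simp
  · intro c
    simp only [f, LinearMap.comp_apply, ← comul_comp]
    rw [← map_sw, sw_antipode_comp, map_smul, comul_one]
  · intro c
    have h1 : ∀ p q, H.compT x y x (Coalgebra.comul p) (h q) =
        sw k (fun p₁ p₂ => sw k (fun q₁ q₂ => (p₁ ⋆ S q₂) ⊗ₜ[k] (p₂ ⋆ S q₁)) q) p := fun p q => by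
      rw [← sw_eq_comul, hh, map_sw_apply]
      exact sw_congr (fun u v => map_sw _ _ q) p
    -- In Sweedler notation, `p S(q₃) ⊗ q₁ S(q₂)`: the second factor collapses to the unit.
    have h2 : ∀ p q : A x y, sw k (fun u v => sw k (fun v₁ v₂ => (p ⋆ S v₂) ⊗ₜ[k] (u ⋆ S v₁)) v) q =
        (p ⋆ S q) ⊗ₜ[k] H.one x := fun p q => by
      rw [← sw_coassoc (fun u v w => (p ⋆ S w) ⊗ₜ[k] (u ⋆ S v))]
      · simp only [← tmul_sw, sw_comp_antipode, TensorProduct.tmul_smul]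
        refine sw_counit_left (f := fun w => (p ⋆ S w) ⊗ₜ[k] H.one x) ?_ q
        constructor <;> intros <;> simp [TensorProduct.add_tmul, TensorProduct.smul_tmul']
      · intro; constructor <;> intros <;> simp [TensorProduct.tmul_add]
      · intro; constructor <;> intros <;>
          simp [TensorProduct.tmul_add, TensorProduct.add_tmul, TensorProduct.smul_tmul']
    simp only [h1]
    rw [sw_coassoc (fun u v q => sw k (fun q₁ q₂ => (u ⋆ S q₂) ⊗ₜ[k] (v ⋆ S q₁)) q)]
    · simp only [h2]
      rw [← sw_tmul_right, sw_comp_antipode, TensorProduct.smul_tmul']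
    · intro; constructor <;> intros <;>
        simp [TensorProduct.tmul_add, TensorProduct.add_tmul, ← TensorProduct.smul_tmul']
    · intro; constructor <;> intros <;>
        simp [isBilin_iff, TensorProduct.tmul_add, TensorProduct.add_tmul, ← TensorProduct.smul_tmul']

end HopfCategory

/-! ### The square of the antipode, integrals, and the left inverse. -/

namespace HopfCategory

variable {k X : Type*} [CommRing k] {A : X → X → Type*}
  [∀ x y, AddCommGroup (A x y)] [∀ x y, Module k (A x y)] [∀ x y, Coalgebra k (A x y)]
  (H : HopfCategory k A)

local infixl:70 " ⋆ " => comp H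

local notation "S" => HopfCategory.antipode H _ _

variable {x y z t : X} {M : Type*} [AddCommGroup M] [Module k M]

theorem sw_antipode {F : A y x → A y x → M} (h : IsBilin k F) (a : A x y) :
    sw k F (S a) = sw k (fun p q => F (S q) (S p)) a := by
  rw [sw_eq h, comul_antipode, map_sw]
  simp

theorem sw_antipode_antipode {F : A x y → A x y → M} (h : IsBilin k F) (a : A x y) :
    sw k F (S (S a)) = sw k (fun p q => F (S (S p)) (S (S q))) a := by
  rw [sw_antipode H h, sw_antipode]
  constructor <;> intros <;> simp [h.1, h.2, h.3, h.4]

/-- The antipode is applied to the antipode axiom. Such identities, with `S²`, do the work usually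
done by the inverse of `S`. -/
theorem sw_antipode_antipode_comp_antipode (a : A x y) :
    sw k (fun p q => S (S q) ⋆ S p) a = Coalgebra.counit (R := k) a • H.one x := by
  have := congrArg (H.antipode x x) (H.sw_comp_antipode a)
  rw [map_smul, map_sw, antipode_one] at this
  simpa only [antipode_comp] using this

theorem sw_antipode_comp_antipode_antipode (a : A x y) :
    sw k (fun p q => S q ⋆ S (S p)) a = Coalgebra.counit (R := k) a • H.one y := by
  have := congrArg (H.antipode y y) (H.sw_antipode_comp a)
  rw [map_smul, map_sw, antipode_one] at this
  simpa only [antipode_comp] using this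

/-- The integrals on `A x x`: linear forms `t` with `h₍₁₎ t(h₍₂₎) = t(h) 1_x`. -/
def IsIntegral (x : X) (t : A x x →ₗ[k] k) : Prop :=
  ∀ c, contract t c = t c • H.one x

/-! ### Integrals from traces. -/

section Trace

variable {ι : Type*} [Fintype ι] (e : ι → A x x) (e' : ι → A x x →ₗ[k] k)

/-- The linear form `c ↦ ∑ e' j (f(b₍₂₎) b₍₁₎)` with `b = c S(S(e j))`. -/
noncomputable def traceForm (f : A x x →ₗ[k] k) : A x x →ₗ[k] k :=
  ∑ j, e' j ∘ₗ contract f ∘ₗ (H.compL x x x).flip (S (S (e j)))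

theorem traceForm_apply (f : A x x →ₗ[k] k) (c : A x x) :
    H.traceForm e e' f c = ∑ j, e' j (contract f (c ⋆ S (S (e j)))) := by
  simp [traceForm, compL_apply]

variable {e e'} (he : ∀ c, ∑ j, e' j c • e j = c)

/-- The right side expands to `g(c₂ S²(a₃)) c₁ S²(a₂) S(a₁)`, where `S²(a₂) S(a₁)` collapses to a
counit. -/
theorem contract_flip_antipode_antipode (g : A x z →ₗ[k] k) (a : A y z) (c : A x y) :
    sw k (fun p q => g (q ⋆ S (S a)) • p) c =
      sw k (fun p q => sw k (fun u v => g v • (u ⋆ S p)) (c ⋆ S (S q))) a := by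
  have hB : ∀ p : A y z, IsBilin k (fun u v : A x z => g v • (u ⋆ S p)) := fun p => by
    constructor <;> intros <;> simp [add_smul, smul_smul, mul_comm]
  have hB' : ∀ (p : A y z) (u v : A x y),
      IsBilin k (fun u' v' : A y z => g (v ⋆ v') • (u ⋆ u' ⋆ S p)) := fun p u v => by
    constructor <;> intros <;> simp [add_smul, smul_smul, mul_comm]
  simp only [sw_comp_base H (hB _), sw_antipode_antipode H (hB' _ _ _)]
  rw [sw_comm]
  refine sw_congr (fun u v => ?_) c
  rw [← sw_coassoc (fun p q r => g (v ⋆ S (S r)) • (u ⋆ S (S q) ⋆ S p))]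
  · simp only [comp_assoc, sw_smul_fun, ← comp_sw, sw_antipode_antipode_comp_antipode, comp_smul,
      comp_one, smul_comm _ (Coalgebra.counit (R := k) _)]
    refine (sw_counit_left (f := fun q => g (v ⋆ S (S q)) • u) ?_ a).symm
    constructor <;> intros <;> simp [add_smul, mul_smul]
  · intro; constructor <;> intros <;> simp [smul_smul, mul_comm]
  · intro; constructor <;> intros <;> simp [add_smul, smul_smul, mul_comm]

include he

/-- The coproduct of `e j` is traded for a convolution product of dual basis forms; what remains is
an instance of `u₁ S(u₂) = ε(u) 1`. -/
theorem isIntegral_traceForm (f : A x x →ₗ[k] k) : H.IsIntegral x (H.traceForm e e' f) := by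
  intro c
  have hB : ∀ (g : A x x →ₗ[k] k) (p : A x x), IsBilin k (fun u v : A x x => g v • (u ⋆ S p)) :=
    fun g p => by constructor <;> intros <;> simp [add_smul, smul_smul, mul_comm]
  have hS : IsBilin k (fun u v : A x x => u ⋆ S v) := by
    constructor <;> intros <;> simp
  calc contract (H.traceForm e e' f) c
      = ∑ j, sw k (fun p q => (e' j ∘ₗ contract f) (q ⋆ S (S (e j))) • p) c := by
        simp only [contract_apply, traceForm_apply, Finset.sum_smul, sw_finset_sum,
          LinearMap.comp_apply]
    _ = ∑ j, sw k (fun p q => sw k (fun u v => e' j v • (u ⋆ S p)) (contract f (c ⋆ S (S q))))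
          (e j) := by
        simp only [sw_contract (hB _ _)]
        exact Finset.sum_congr rfl fun j _ =>
          H.contract_flip_antipode_antipode (e' j ∘ₗ contract f) (e j) c
    _ = ∑ l, ∑ m, sw k (fun u v => (e' l ∘ₗ contract (e' m)) v • (u ⋆ S (e l)))
          (contract f (c ⋆ S (S (e m)))) := by
        refine sum_sw_dualBasis he (G := fun g p q =>
          sw k (fun u v => g v • (u ⋆ S p)) (contract f (c ⋆ S (S q)))) ?_ ?_
        · intros; constructor <;> intros <;> simp [add_smul, mul_smul]
        · intro g
          constructor
          · intros; simp
          · intro r p q; simp only [map_smul, comp_smul, ← sw_smul_fun, smul_comm r]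
          · intros; simp [sw_add (hB _ _)]
          · intros; simp [sw_smul (hB _ _)]
    -- The sum over `l` reassembles `contract (e' m) v` inside `S`.
    _ = ∑ m, sw k (fun u v => u ⋆ S (contract (e' m) v)) (contract f (c ⋆ S (S (e m)))) := by
        rw [Finset.sum_comm]
        refine Finset.sum_congr rfl fun m _ => ?_
        rw [← sw_finset_sum]
        refine sw_congr (fun u v => ?_) _
        exact sum_dualBasis_smul_map he (f := fun w => u ⋆ S w)
          (by constructor <;> intros <;> simp) (contract (e' m) v)
    -- By colinearity `contract (e' m)` moves outside the coproduct, and its counit is `e' m`.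
    _ = H.traceForm e e' f c • H.one x := by
        simp only [← sw_contract hS, sw_comp_antipode, counit_contract, traceForm_apply,
          Finset.sum_smul]

/-- The double sum is `∑ e'ⱼ(S(q) S²(p))` over the coproduct `p ⊗ q` of `e j`, that is, `∑ ε(e j) e'
j(1) = ε(1)`. -/
theorem sum_traceForm : ∑ i, H.traceForm e e' (e' i) (S (e i)) = 1 := by
  have h := sum_sw_dualBasis he (G := fun g p q => g (S q ⋆ S (S p)))
    (by intros; constructor <;> intros <;> simp) (by intros; constructor <;> intros <;> simp)
  simp only [← map_sw, sw_antipode_comp_antipode_antipode, map_smul] at h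
  have h₁ := congrArg (Coalgebra.counit (R := k)) (he (H.one x))
  rw [counit_one, map_sum] at h₁
  simp only [traceForm_apply]
  rw [Finset.sum_comm]
  refine h.symm.trans (Eq.trans ?_ h₁)
  simp [mul_comm]

end Trace

/-- The integral property at `b S(a₁)`, multiplied by `a₂`, gives `t(b₂ S(a₁)) b₁ S(a₂) a₃`, in
which `S(a₂) a₃` collapses. -/
theorem contract_comp_antipode {t : A x x →ₗ[k] k} (ht : H.IsIntegral x t) (a b : A x z) :
    sw k (fun u v => t (v ⋆ S a) • u) b = sw k (fun p q => t (b ⋆ S p) • q) a := by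
  have ht' : ∀ (w : A x x) (q : A x z), t w • q = sw k (fun u v => t v • (u ⋆ q)) w := fun w q => by
    have := congrArg (fun c => c ⋆ q) (ht w)
    simp only [contract_apply, sw_comp, smul_comp, one_comp] at this
    exact this.symm
  have hB : ∀ q : A x z, IsBilin k (fun u v : A x x => t v • (u ⋆ q)) := fun q => by
    constructor <;> intros <;> simp [add_smul, smul_smul, mul_comm]
  have hB' : ∀ (q u v : A x z),
      IsBilin k (fun u' v' : A z x => t (v ⋆ v') • (u ⋆ u' ⋆ q)) := fun q u v => by
    constructor <;> intros <;> simp [add_smul, smul_smul, mul_comm]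
  rw [sw_congr (fun p q => ht' (b ⋆ S p) q)]
  simp only [sw_comp_base H (hB _), sw_antipode H (hB' _ _ _)]
  rw [sw_comm]
  refine sw_congr (fun u v => ?_) b
  rw [sw_coassoc (fun p q r => t (v ⋆ S p) • (u ⋆ S q ⋆ r))]
  · simp only [comp_assoc, sw_smul_fun, ← comp_sw, sw_antipode_comp, comp_smul,
      comp_one, smul_comm _ (Coalgebra.counit (R := k) _)]
    refine (sw_counit_right (f := fun q => t (v ⋆ S q) • u) ?_ a).symm
    constructor <;> intros <;> simp [add_smul, mul_smul]
  · intro; constructor <;> intros <;> simp [add_smul, smul_smul, mul_comm]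
  · intro; constructor <;> intros <;> simp [smul_smul, mul_comm]

/-! ### The left inverse of the antipode. -/

section LeftInverse

variable {ι : Type*} [Fintype ι] (e : ι → A x z) (e' : ι → A x z →ₗ[k] k)

/-- A map which, when `t` is an integral, sends `S a` to `t(c) a`. -/
noncomputable def preimage (t : A x x →ₗ[k] k) (c : A x x) : A z x →ₗ[k] A x z :=
  IsLinearMap.mk' (fun b => ∑ j, sw k (fun p q =>
      e' j (contract (t ∘ₗ (H.compL x z x).flip b) (c ⋆ S (S p))) • q) (e j)) <| by
    constructor <;> intros <;>
      simp [LinearMap.comp_add, LinearMap.comp_smul, add_smul, mul_smul, Finset.sum_add_distrib,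
        Finset.smul_sum]

variable {e e'} (he : ∀ c, ∑ j, e' j c • e j = c)
include he

/-- Moving `S a` across the integral and summing over the dual basis leaves `t(c S²(a₂) S(a₁)) a₃`,
and `S²(a₂) S(a₁)` is a counit. -/
theorem preimage_antipode {t : A x x →ₗ[k] k} (ht : H.IsIntegral x t) (c : A x x) (a : A x z) :
    H.preimage e e' t c (S a) = t c • a := by
  have hB : ∀ a₁, IsBilin k (fun p q : A x z => t (c ⋆ S (S p) ⋆ S a₁) • q) := fun a₁ => by
    constructor <;> intros <;> simp [add_smul, smul_smul, mul_comm]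
  calc H.preimage e e' t c (S a)
      = ∑ j, sw k (fun p q => e' j (sw k (fun a₁ a₂ => t (c ⋆ S (S p) ⋆ S a₁) • a₂) a) • q)
          (e j) := by
        simp only [← contract_comp_antipode H ht]
        simp [preimage, contract_apply, compL_apply]
    _ = sw k (fun a₁ a₂ => ∑ j, e' j a₂ • sw k (fun p q => t (c ⋆ S (S p) ⋆ S a₁) • q) (e j)) a := by
        rw [sw_finset_sum]
        refine Finset.sum_congr rfl fun j _ => ?_
        simp only [← sw_smul_fun]
        rw [sw_comm]
        refine sw_congr (fun p q => ?_) _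
        have := map_sw ((LinearMap.toSpanSingleton k _ q) ∘ₗ e' j)
          (fun a₁ a₂ => t (c ⋆ S (S p) ⋆ S a₁) • a₂) a
        simpa [smul_smul, mul_comm] using this
    _ = sw k (fun a₁ a₂ => sw k (fun p q => t (c ⋆ S (S p) ⋆ S a₁) • q) a₂) a :=
        sw_congr (fun a₁ a₂ => sum_dualBasis_smul_map he
          ⟨fun _ _ => sw_add (hB a₁) _ _, fun _ _ => sw_smul (hB a₁) _ _⟩ a₂) a
    _ = t c • a := by
        rw [← sw_coassoc (fun a₁ p q => t (c ⋆ S (S p) ⋆ S a₁) • q)]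
        · have h : ∀ p q : A x z, sw k (fun u v => t (c ⋆ S (S v) ⋆ S u) • q) p =
              (Coalgebra.counit (R := k) p) • t c • q := fun p q => by
            have := map_sw ((LinearMap.toSpanSingleton k _ q) ∘ₗ t ∘ₗ H.compL x x x c)
              (fun u v => S (S v) ⋆ S u) p
            rw [sw_antipode_antipode_comp_antipode] at this
            simpa [compL_apply, comp_assoc, mul_smul] using this.symm
          simp only [h]
          exact sw_counit_left (f := fun q => t c • q)
            (by constructor <;> intros <;> simp [smul_smul, mul_comm]) a
        · intro; constructor <;> intros <;> simp [add_smul, mul_smul]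
        · intro; constructor <;> intros <;> simp [add_smul, smul_smul, mul_comm]

end LeftInverse

theorem exists_dualBasis (k C : Type*) [CommRing k] [AddCommGroup C] [Module k C]
    [Module.Finite k C] [Module.Projective k C] :
    ∃ (n : ℕ) (e : Fin n → C) (e' : Fin n → C →ₗ[k] k), ∀ c, ∑ j, e' j c • e j = c := by
  obtain ⟨n, f, g, -, -, h⟩ := Module.Finite.exists_comp_eq_id_of_projective k C
  refine ⟨n, fun j => f (Pi.single j 1), fun j => LinearMap.proj j ∘ₗ g, fun c => ?_⟩
  have := LinearMap.congr_fun h c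
  conv_rhs => rw [← LinearMap.id_apply (R := k) c, ← this, LinearMap.comp_apply,
    ← LinearMap.sum_single_apply (φ := fun _ => k) (v := g c)]
  simp [← map_smul, ← Pi.single_smul]

/-- Each antipode map between finitely generated projective hom-modules has a linear
left inverse. -/
theorem exists_leftInverse_antipode [∀ x y, Module.Finite k (A x y)]
    [∀ x y, Module.Projective k (A x y)] (x z : X) :
    ∃ L : A z x →ₗ[k] A x z, ∀ a, L (S a) = a := by
  obtain ⟨n, e, e', he⟩ := exists_dualBasis k (A x x)
  obtain ⟨m, d, d', hd⟩ := exists_dualBasis k (A x z)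
  refine ⟨∑ i, H.preimage d d' (H.traceForm e e' (e' i)) (S (e i)), fun a => ?_⟩
  simp only [LinearMap.sum_apply, H.preimage_antipode hd (H.isIntegral_traceForm he _)]
  rw [← Finset.sum_smul, H.sum_traceForm he, one_smul]

end HopfCategory

theorem mainTheorem2 {k : Type*} [CommRing k] {X : Type*} {A : X → X → Type*}
    [∀ x y, AddCommGroup (A x y)] [∀ x y, Module k (A x y)] [∀ x y, Coalgebra k (A x y)]
    [∀ x y, Module.Finite k (A x y)] [∀ x y, Module.Projective k (A x y)]
    (H : HopfCategory k A) (x y : X) :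
    Function.Bijective (H.antipode x y) := by
  obtain ⟨L, hL⟩ := H.exists_leftInverse_antipode x y
  obtain ⟨L', hL'⟩ := H.exists_leftInverse_antipode y x
  refine ⟨Function.LeftInverse.injective hL, fun b => ?_⟩
  have hs : Function.Surjective (L' ∘ₗ L) := fun b => 
    ⟨H.antipode x y (H.antipode y x b), by simp [hL, hL']⟩
  -- Injectivity of `L' ∘ L` turns `L (S (L b)) = L b` into `S (L b) = b`.
  have hi := OrzechProperty.injective_of_surjective_endomorphism (L' ∘ₗ L) hs
  exact ⟨L b, hi (by simp [hL])⟩
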